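/- For every integer $t\ge 0$ let $$\mathcal U_{2t}(q)=\sum_{1\le k_1<\cdots<k_t}\frac{q^{k_1+\cdots+k_t}}{(1-q^{k_1})^2\cdots(1-q^{k_t})^2},\qquad \mathcal C_{2t}(q)=\sum_{0<s_1<\cdots<s_t}\frac{q^{2s_1+\cdots+2s_t-t}}{(1-q^{2s_1-1})^2\cdots(1-q^{2s_t-1})^2}$$ be MacMahon's series, where the $k_i$ and $s_i$ are integers and the sums are taken in $\mathbb Z[[q]]$ (so $\mathcal U_0=\mathcal C_0=1$). The sums $\sum_{t\ge0}\mathcal U_{2t}(q)$ and $\sum_{t\ge0}\mathcal C_{2t}(q)$ converge coefficientwise in $\mathbb Z[[q]]$. Write $$\sum_{t\ge0}\mathcal U_{2t}(q)=\sum_{n\ge0}u(n)q^n,\qquad \sum_{t\ge0}\mathcal C_{2t}(q)=\sum_{n\ge0}\kappa(n)q^n .$$ Then for every integer $n\ge0$, $$u(3n+2)\equiv 0 \pmod 3\qquad\text{and}\qquad \kappa(9n+6)\equiv 0\pmod 3 .$$ -/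

import Mathlib

open scoped PowerSeries PowerSeries.WithPiTopology

noncomputable section

/-- The formal power series `q ^ m / (1 - q ^ m) ^ 2` in `ℤ⟦q⟧`, to be used for `m ≥ 1` only, where
the denominator has constant coefficient `1` and `invOfUnit _ 1` is its inverse. -/
def macMahonFactor (m : ℕ) : ℤ⟦X⟧ :=
  PowerSeries.X ^ m * PowerSeries.invOfUnit ((1 - PowerSeries.X ^ m) ^ 2) 1

/-- The summand is the quotient that it is meant to be. -/
theorem macMahonFactor_mul {m : ℕ} (hm : 1 ≤ m) :
    macMahonFactor m * (1 - PowerSeries.X ^ m) ^ 2 = PowerSeries.X ^ m := by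
  have h : PowerSeries.constantCoeff ((1 - (PowerSeries.X : ℤ⟦X⟧) ^ m) ^ 2) = ((1 : ℤˣ) : ℤ) := by
    simp [show m ≠ 0 by omega]
  rw [macMahonFactor, mul_assoc, mul_comm (PowerSeries.invOfUnit _ _),
    PowerSeries.mul_invOfUnit _ _ h, mul_one]

/-- Strictly increasing `t`-tuples `1 ≤ k₁ < ⋯ < k_t`, encoded as the sets `{k₁, …, k_t}` of `t`
positive integers. -/
abbrev IncreasingTuple (t : ℕ) : Type := {s : Finset ℕ+ // s.card = t}

/-- MacMahon's series
`𝒰_{2t}(q) = ∑_{1 ≤ k₁ < ⋯ < k_t} q^{k₁ + ⋯ + k_t} / ((1 - q^{k₁})² ⋯ (1 - q^{k_t})²)`,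
the sum being taken in `ℤ⟦q⟧` with coefficientwise convergence. -/
def macMahonU (t : ℕ) : ℤ⟦X⟧ :=
  ∑' s : IncreasingTuple t, ∏ k ∈ s.1, macMahonFactor (k : ℕ)

/-- MacMahon's series `𝒞_{2t}(q) = ∑_{0 < s₁ < ⋯ < s_t}
q^{2s₁ + ⋯ + 2s_t - t} / ((1 - q^{2s₁-1})² ⋯ (1 - q^{2s_t-1})²)`,
the sum being taken in `ℤ⟦q⟧` with coefficientwise convergence. -/
def macMahonC (t : ℕ) : ℤ⟦X⟧ :=
  ∑' s : IncreasingTuple t, ∏ k ∈ s.1, macMahonFactor (2 * (k : ℕ) - 1)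

/-- The sums that define `macMahonU` and `macMahonC` converge. -/
theorem summable_prod_macMahonFactor (f : ℕ+ → ℕ) (hf : ∀ k : ℕ+, (k : ℕ) ≤ f k) (t : ℕ) :
    Summable fun s : IncreasingTuple t => ∏ k ∈ s.1, macMahonFactor (f k) := by
  refine Pi.summable.2 fun d => ?_
  refine summable_of_hasFiniteSupport ?_
  obtain ⟨n, rfl⟩ : ∃ n, d = Finsupp.single () n := ⟨d (), by ext; simp⟩
  have key : ∀ s : IncreasingTuple t,
      PowerSeries.coeff n (∏ k ∈ s.1, macMahonFactor (f k)) ≠ 0 →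
        s ∈ (Subtype.val : IncreasingTuple t → Finset ℕ+) ⁻¹'
          (↑(Finset.Icc (1 : ℕ+) n.succPNat).powerset : Set (Finset ℕ+)) := by
    intro s hs
    simp only [Set.mem_preimage, Finset.coe_powerset, Set.mem_powerset_iff, Finset.coe_subset]
    intro k hk
    refine Finset.mem_Icc.2 ⟨one_le, ?_⟩
    by_contra hlt
    apply hs
    have h1 : (PowerSeries.X : ℤ⟦X⟧) ^ (f k) ∣ ∏ k ∈ s.1, macMahonFactor (f k) :=
      (Dvd.intro _ rfl : _ ∣ macMahonFactor (f k)).trans (Finset.dvd_prod_of_mem _ hk)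
    refine PowerSeries.X_pow_dvd_iff.1 h1 n ?_
    have h2 : n.succPNat < k := not_le.1 hlt
    have h3 : (n.succPNat : ℕ) < (k : ℕ) := h2
    have h4 := hf k
    simp at h3
    omega
  exact ((Finset.finite_toSet _).preimage Subtype.val_injective.injOn).subset key

theorem summable_macMahonU (t : ℕ) :
    Summable fun s : IncreasingTuple t => ∏ k ∈ s.1, macMahonFactor (k : ℕ) :=
  summable_prod_macMahonFactor (fun k => (k : ℕ)) (fun _ => le_rfl) t

theorem summable_macMahonC (t : ℕ) :
    Summable fun s : IncreasingTuple t => ∏ k ∈ s.1, macMahonFactor (2 * (k : ℕ) - 1) :=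
  summable_prod_macMahonFactor (fun k => 2 * (k : ℕ) - 1) (fun k => by have := k.pos; omega) t

end

/-! Summing over all `t` turns the series into the products of `1 + x/(1-x)^2` with `x = q^n`, over
all `n` or over odd `n`. Modulo 3 each factor is `((1+x)/(1-x))^2`. With `φ = ∑ q^(j^2)` and `ψ(q) =
φ(-q)`, the Jacobi triple product and Euler's identity show that the two products are `1/ψ^2` and
`φ/ψ`.

In characteristic 3, `g(q^3) = g^3`, so splitting `j` modulo 3 gives `φ = φ^9 - q W^3` with `W = ∑
q^(3j^2+2j)`, and likewise `ψ = ψ^9 + q V^3` with `V(q) = W(-q)` (`theta_eq_pow_nine_sub`). Since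
`1/ψ^2 = ψ/ψ^3` and `ψ` has no exponents `≡ 2 (mod 3)`, the first congruence follows. For the
second, `φ/ψ = φψ^2/ψ^3` is dissected twice; the final cancellation rests on `Wφ = Vψ`, both sides
being `∏ (1 - q^(2n))^4` modulo 3. -/

open Filter Topology Finset PowerSeries PowerSeries.WithPiTopology

/-! ### Gaussian binomials and the `q`-binomial theorem -/

/-- The Gaussian binomial coefficient with parameter `p`. -/
def gaussBinom {R : Type*} [CommRing R] (p : R) : ℕ → ℕ → R
  | _, 0 => 1
  | 0, _ + 1 => 0
  | n + 1, k + 1 => p ^ (k + 1) * gaussBinom p n (k + 1) + gaussBinom p n k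

section GaussBinom

variable {R : Type*} [CommRing R] (p : R)

theorem gaussBinom_zero_right (n : ℕ) : gaussBinom p n 0 = 1 := by
  cases n <;> rfl

theorem gaussBinom_succ_succ (n k : ℕ) : gaussBinom p (n + 1) (k + 1) =
    p ^ (k + 1) * gaussBinom p n (k + 1) + gaussBinom p n k := rfl

theorem gaussBinom_eq_zero_of_lt {n k : ℕ} (h : n < k) : gaussBinom p n k = 0 := by
  induction n generalizing k with
  | zero => obtain ⟨k, rfl⟩ := Nat.exists_eq_succ_of_ne_zero h.ne'; rfl
  | succ n ih =>
    obtain ⟨k, rfl⟩ := Nat.exists_eq_succ_of_ne_zero (Nat.ne_zero_of_lt h)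
    rw [Nat.succ_eq_add_one, gaussBinom_succ_succ, ih (by omega), ih (by omega)]
    simp

theorem gaussBinom_self (n : ℕ) : gaussBinom p n n = 1 := by
  induction n with
  | zero => rfl
  | succ n ih => rw [gaussBinom_succ_succ, ih, gaussBinom_eq_zero_of_lt p (by omega)]; simp

/-- The quotient formula for Gaussian binomials with denominators cleared, so that no `1 - p ^ i`
need be invertible. -/
theorem gaussBinom_mul_prod_mul_prod (k l : ℕ) :
    gaussBinom p (k + l) k * (∏ i ∈ range k, (1 - p ^ (i + 1))) * ∏ i ∈ range l, (1 - p ^ (i + 1)) =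
      ∏ i ∈ range (k + l), (1 - p ^ (i + 1)) := by
  induction k generalizing l with
  | zero => simp [gaussBinom_zero_right]
  | succ k ihk =>
    induction l with
    | zero => simp [gaussBinom_self]
    | succ l ihl =>
      have h1 := ihk (l + 1)
      rw [show k + 1 + (l + 1) = (k + 1 + l) + 1 by ring, gaussBinom_succ_succ,
        prod_range_succ _ (k + 1 + l), ← ihl]
      rw [show k + (l + 1) = k + 1 + l by ring, ← ihl] at h1
      rw [prod_range_succ _ l] at h1 ⊢
      rw [prod_range_succ _ k] at h1 ⊢
      linear_combination (1 - p ^ (k + 1)) * h1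

/-- The `q`-binomial theorem, in homogeneous form. -/
theorem prod_add_mul_pow_eq_sum_gaussBinom (x y : R) (n : ℕ) :
    ∏ i ∈ range n, (x + y * p ^ i) =
      ∑ k ∈ range (n + 1), p ^ (k.choose 2) * gaussBinom p n k * y ^ k * x ^ (n - k) := by
  induction n generalizing y with
  | zero => simp [gaussBinom_zero_right]
  | succ n ih =>
    rw [prod_range_succ']
    have h : ∀ i ∈ range n, x + y * p ^ (i + 1) = x + (y * p) * p ^ i := fun i _ => by ring
    rw [prod_congr rfl h, ih, pow_zero, mul_one, mul_add, add_comm, sum_range_succ' _ (n + 1)]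
    have e1 : (∑ k ∈ range (n + 1),
        p ^ (k.choose 2) * gaussBinom p n k * (y * p) ^ k * x ^ (n - k)) * x =
        ∑ k ∈ range (n + 1), p ^ ((k + 1).choose 2) * (p ^ (k + 1) * gaussBinom p n (k + 1)) *
          y ^ (k + 1) * x ^ (n - k) + x ^ (n + 1) := by
      rw [sum_range_succ', sum_range_succ _ n, gaussBinom_eq_zero_of_lt p (Nat.lt_succ_self n)]
      simp only [mul_zero, zero_mul, add_zero, add_mul, sum_mul]
      congr 1
      · refine sum_congr rfl fun k hk => ?_
        rw [mem_range] at hk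
        rw [show n - k = n - (k + 1) + 1 by omega]
        ring
      · simp [gaussBinom_zero_right, pow_succ]
    rw [e1, sum_mul, ← add_assoc]
    simp only [gaussBinom_zero_right, Nat.choose_zero_succ, pow_zero, mul_one, one_mul, tsub_zero,
      Nat.add_sub_add_right]
    congr 1
    rw [← sum_add_distrib]
    refine sum_congr rfl fun k _ => ?_
    rw [gaussBinom_succ_succ, show (k + 1).choose 2 = k + k.choose 2 by
      rw [Nat.choose_succ_succ' k 1, Nat.choose_one_right], pow_add]
    ring

end GaussBinom

/-! ### The Jacobi triple product for formal power series -/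

section Theta

theorem tendsto_order_of_X_pow_dvd {R : Type*} [CommRing R] {ι : Type*} [Preorder ι] {g : ι → ℕ}
    (hg : Tendsto g atTop atTop) {f : ι → R⟦X⟧} (h : ∀ i, X ^ (g i) ∣ f i) :
    Tendsto (fun i => (f i).order) atTop (𝓝 ⊤) := by
  refine ENat.tendsto_nhds_top_iff_natCast_lt.2 fun n => ?_
  filter_upwards [hg.eventually_gt_atTop n] with i hi
  exact lt_of_lt_of_le (by exact_mod_cast hi) (nat_le_order _ _ (X_pow_dvd_iff.1 (h i)))

/-- The finite form of the Jacobi triple product. -/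
theorem prod_mul_prod_eq_sum_gaussBinom {R : Type*} [CommRing R] {c d : ℕ} {e : ℤ → ℕ}
    (he : ∀ j : ℤ, 2 * (e j : ℤ) = (c + d : ℕ) * (j * (j - 1)) + 2 * c * j) (N : ℕ) :
    (∏ i ∈ range N, ((1 : R⟦X⟧) + X ^ ((c + d) * i + c))) *
        ∏ i ∈ range N, (1 + X ^ ((c + d) * i + d)) =
      ∑ k ∈ range (2 * N + 1), gaussBinom (X ^ (c + d)) (2 * N) k * X ^ e (k - N) := by
  have h := prod_add_mul_pow_eq_sum_gaussBinom ((X : R⟦X⟧) ^ (c + d)) (X ^ ((c + d) * N)) (X ^ c)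
    (2 * N)
  have hsum : ∀ n : ℕ, 2 * ∑ i ∈ range n, (c + (c + d) * i) + (c + d) * n =
      2 * (c * n) + (c + d) * n ^ 2 := by
    intro n
    induction n with
    | zero => simp
    | succ n ih => rw [sum_range_succ]; linarith
  have hc (k : ℕ) : 2 * k.choose 2 + k = k ^ 2 := by
    induction k with
    | zero => simp
    | succ k ih => rw [Nat.choose_succ_succ' k 1, Nat.choose_one_right]; linarith
  -- The power of `X` pulled out of the `2N` factors: `X ^ (c + (c + d) * i)` from each of the first
  -- `N`, `X ^ ((c + d) * N)` from each of the others.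
  set e₀ := ∑ i ∈ range N, (c + (c + d) * i) + (c + d) * N * N with he₀
  have hL : ∏ i ∈ range (2 * N), ((X : R⟦X⟧) ^ ((c + d) * N) + X ^ c * (X ^ (c + d)) ^ i) =
      X ^ e₀ * ((∏ i ∈ range N, ((1 : R⟦X⟧) + X ^ ((c + d) * i + c))) *
        ∏ i ∈ range N, (1 + X ^ ((c + d) * i + d))) := by
    rw [two_mul, prod_range_add, he₀, pow_add _ (∑ i ∈ range N, _), ← prod_pow_eq_pow_sum,
      pow_mul _ ((c + d) * N)]
    rw [← prod_range_reflect (fun i => 1 + X ^ ((c + d) * i + d))]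
    have h1 : ∀ i ∈ range N, ((X : R⟦X⟧) ^ ((c + d) * N) + X ^ c * (X ^ (c + d)) ^ i) =
        X ^ (c + (c + d) * i) * (1 + X ^ ((c + d) * (N - 1 - i) + d)) := by
      intro i hi
      rw [mem_range] at hi
      obtain ⟨r, rfl⟩ : ∃ r, N = i + 1 + r := ⟨N - i - 1, by omega⟩
      rw [show i + 1 + r - 1 - i = r by omega]
      ring
    have h2 : ∀ i ∈ range N, ((X : R⟦X⟧) ^ ((c + d) * N) + X ^ c * (X ^ (c + d)) ^ (N + i)) =
        X ^ ((c + d) * N) * (1 + X ^ ((c + d) * i + c)) := by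
      intro i _
      ring
    rw [prod_congr rfl h1, prod_congr rfl h2, prod_mul_distrib, prod_mul_distrib, prod_const,
      card_range]
    ring
  have hR : ∑ k ∈ range (2 * N + 1), ((X : R⟦X⟧) ^ (c + d)) ^ k.choose 2 *
        gaussBinom (X ^ (c + d)) (2 * N) k * (X ^ c) ^ k * (X ^ ((c + d) * N)) ^ (2 * N - k) =
      X ^ e₀ * ∑ k ∈ range (2 * N + 1), gaussBinom (X ^ (c + d)) (2 * N) k * X ^ e (k - N) := by
    rw [mul_sum]
    refine sum_congr rfl fun k hk => ?_
    rw [mem_range] at hk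
    have hexp : (c + d) * k.choose 2 + c * k + (c + d) * N * (2 * N - k) = e₀ + e (k - N) := by
      have h1 := he (k - N)
      have h2 := hsum N
      have h3 := hc k
      zify [show k ≤ 2 * N by omega] at h2 h3 he₀ ⊢
      push_cast at h1
      rw [← mul_right_inj' (two_ne_zero (α := ℤ)), he₀]
      linear_combination ((c : ℤ) + d) * h3 - h2 - h1
    rw [← mul_left_comm, ← pow_add, ← hexp]
    ring
  rw [hL, hR] at h
  exact (X_pow_mul_inj).1 h

/-- Rewrite `2 * e j` as `c * j * (j + 1) + d * j * (j - 1)`, where both products of consecutive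
integers are nonnegative. -/
theorem natAbs_le_of_two_mul_eq {c d : ℕ} (hc : 1 ≤ c) (hd : 1 ≤ d) {e : ℤ → ℕ}
    (he : ∀ j : ℤ, 2 * (e j : ℤ) = (c + d : ℕ) * (j * (j - 1)) + 2 * c * j) (j : ℤ) :
    j.natAbs ≤ e j := by
  have h := he j
  have h1 : 0 ≤ j * (j + 1) := by
    rcases le_or_gt 0 j with hj | hj
    · positivity
    · exact mul_nonneg_of_nonpos_of_nonpos hj.le (by omega)
  have h2 : 0 ≤ j * (j - 1) := by
    rcases le_or_gt j 0 with hj | hj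
    · exact mul_nonneg_of_nonpos_of_nonpos hj (by omega)
    · exact mul_nonneg hj.le (by omega)
  zify at *
  have h3 : 0 ≤ ((c : ℤ) - 1) * (j * (j + 1)) := mul_nonneg (by omega) h1
  have h4 : 0 ≤ ((d : ℤ) - 1) * (j * (j - 1)) := mul_nonneg (by omega) h2
  rw [abs_le']
  constructor <;> linarith

variable {R : Type*} [CommRing R] [TopologicalSpace R]

theorem multipliable_one_add_of_X_pow_dvd {f : ℕ → R⟦X⟧} (h : ∀ n, X ^ n ∣ f n) :
    Multipliable fun n => 1 + f n :=
  multipliable_one_add_of_tendsto_order_atTop_nhds_top R (tendsto_order_of_X_pow_dvd tendsto_id h)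

theorem multipliable_one_add_X_pow {g : ℕ → ℕ} (h : ∀ n, n ≤ g n) :
    Multipliable fun n => (1 : R⟦X⟧) + X ^ (g n) :=
  multipliable_one_add_of_X_pow_dvd fun n => pow_dvd_pow _ (h n)

theorem multipliable_one_sub_X_pow_comp {g : ℕ → ℕ} (h : ∀ n, n ≤ g n) :
    Multipliable fun n => (1 : R⟦X⟧) - X ^ (g n) := by
  simp_rw [sub_eq_add_neg]
  exact multipliable_one_add_of_X_pow_dvd fun n => (dvd_neg).2 (pow_dvd_pow _ (h n))

theorem tendsto_zero_of_X_pow_dvd {f : ℕ → R⟦X⟧} (h : ∀ n, X ^ n ∣ f n) :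
    Tendsto f atTop (𝓝 0) := by
  rw [tendsto_iff_coeff_tendsto]
  intro d
  refine tendsto_const_nhds.congr' ?_
  filter_upwards [eventually_gt_atTop d] with n hn
  rw [X_pow_dvd_iff.1 (h n) d hn, map_zero]

variable [T2Space R]

theorem X_pow_dvd_of_tendsto {f : ℕ → R⟦X⟧} {a : R⟦X⟧} (h : Tendsto f atTop (𝓝 a)) {m : ℕ}
    (hf : ∀ᶠ n in atTop, X ^ m ∣ f n) : X ^ m ∣ a := by
  rw [X_pow_dvd_iff]
  intro d hd
  have h1 := (tendsto_iff_coeff_tendsto R f _ a).1 h d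
  refine tendsto_nhds_unique h1 (tendsto_const_nhds.congr' ?_)
  filter_upwards [hf] with n hn
  rw [X_pow_dvd_iff.1 hn d hd]

theorem constantCoeff_tprod {f : ℕ → R⟦X⟧} (hf : Multipliable f)
    (h : ∀ n, constantCoeff (f n) = 1) : constantCoeff (∏' n, f n) = 1 := by
  rw [hf.map_tprod _ (continuous_constantCoeff R)]
  simp [h]

variable [IsTopologicalRing R]

theorem X_pow_dvd_tprod_sub_prod {m : ℕ} (hm : 1 ≤ m) (k : ℕ) :
    (X : R⟦X⟧) ^ (k + 1) ∣
      ∏' n, (1 - (X ^ m) ^ (n + 1)) - ∏ i ∈ range k, (1 - (X ^ m) ^ (i + 1)) := by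
  have hmul : Multipliable fun n => (1 : R⟦X⟧) - (X ^ m) ^ (n + 1) := by
    simp_rw [← pow_mul]
    exact multipliable_one_sub_X_pow_comp fun n => by nlinarith
  refine X_pow_dvd_of_tendsto (hmul.hasProd.tendsto_prod_nat.sub_const _) ?_
  filter_upwards [eventually_ge_atTop k] with n hn
  induction n, hn using Nat.le_induction with
  | base => simp
  | succ n hn ih =>
    have h : (X : R⟦X⟧) ^ (k + 1) ∣ (X ^ m) ^ (n + 1) := by
      rw [← pow_mul]
      exact pow_dvd_pow _ (by nlinarith)
    rw [prod_range_succ]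
    have := dvd_sub ih (h.mul_left (∏ i ∈ range n, (1 - ((X : R⟦X⟧) ^ m) ^ (i + 1))))
    convert this using 1
    ring

/-- Modulo `X ^ (j + 1)` the three finite products in `gaussBinom_mul_prod_mul_prod` all agree with
the infinite product, a unit that can be cancelled. -/
theorem X_pow_dvd_gaussBinom_mul_tprod_sub_one {m : ℕ} (hm : 1 ≤ m) {j k l : ℕ} (hk : j ≤ k)
    (hl : j ≤ l) : (X : R⟦X⟧) ^ (j + 1) ∣
      gaussBinom (X ^ m) (k + l) k * ∏' n, (1 - (X ^ m) ^ (n + 1)) - 1 := by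
  set E : R⟦X⟧ := ∏' n, (1 - (X ^ m) ^ (n + 1)) with hE
  have hmul : Multipliable fun n => (1 : R⟦X⟧) - (X ^ m) ^ (n + 1) := by
    simp_rw [← pow_mul]
    exact multipliable_one_sub_X_pow_comp fun n => by nlinarith
  have hunit : IsUnit E := by
    rw [isUnit_iff_constantCoeff, constantCoeff_tprod hmul]
    · exact isUnit_one
    · intro n
      simp [show m ≠ 0 by omega]
  have h (i : ℕ) (hi : j ≤ i) : (X : R⟦X⟧) ^ (j + 1) ∣
      E - ∏ i ∈ range i, (1 - (X ^ m) ^ (i + 1)) :=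
    (pow_dvd_pow _ (by omega)).trans (X_pow_dvd_tprod_sub_prod hm i)
  obtain ⟨a, ha⟩ := h k hk
  obtain ⟨b, hb⟩ := h l hl
  obtain ⟨c, hc⟩ := h (k + l) (by omega)
  have key := gaussBinom_mul_prod_mul_prod ((X : R⟦X⟧) ^ m) k l
  rw [← hunit.dvd_mul_left]
  refine ⟨gaussBinom (X ^ m) (k + l) k * (a * E + (∏ i ∈ range k, (1 - (X ^ m) ^ (i + 1))) * b)
    - c, ?_⟩
  linear_combination gaussBinom (X ^ m) (k + l) k * (E * ha +
    (∏ i ∈ range k, (1 - (X ^ m) ^ (i + 1))) * hb) - hc + key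

/-- The Jacobi triple product for
`∑ q ^ ((c + d) * j * (j - 1) / 2 + c * j)` as a formal power series. -/
theorem hasSum_X_pow_jacobi {c d : ℕ} (hc : 1 ≤ c) (hd : 1 ≤ d) {e : ℤ → ℕ}
    (he : ∀ j : ℤ, 2 * (e j : ℤ) = (c + d : ℕ) * (j * (j - 1)) + 2 * c * j) :
    HasSum (fun j => (X : R⟦X⟧) ^ e j)
      ((∏' n, (1 - X ^ ((c + d) * (n + 1)))) * ((∏' n, (1 + X ^ ((c + d) * n + c))) *
        ∏' n, (1 + X ^ ((c + d) * n + d)))) := by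
  have habs := natAbs_le_of_two_mul_eq hc hd he
  have hsum : Summable fun j => (X : R⟦X⟧) ^ e j := by
    rw [summable_iff_summable_coeff]
    refine fun n => summable_of_hasFiniteSupport
      ((Set.finite_Icc (-n : ℤ) n).subset fun j hj => ?_)
    rw [Function.mem_support, coeff_X_pow] at hj
    have h1 : n = e j := by by_contra h; simp [h] at hj
    have h2 := habs j
    rw [Set.mem_Icc]
    omega
  convert hsum.hasSum using 1
  have hP (a : ℕ) (ha : 1 ≤ a) :
      Tendsto (fun N => ∏ i ∈ range N, ((1 : R⟦X⟧) + X ^ ((c + d) * i + a))) atTop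
        (𝓝 (∏' n, (1 + X ^ ((c + d) * n + a)))) :=
    (multipliable_one_add_X_pow fun n => by nlinarith).hasProd.tendsto_prod_nat
  set E : R⟦X⟧ := ∏' n, (1 - X ^ ((c + d) * (n + 1))) with hE
  have hS : Tendsto (fun N : ℕ => ∑ k ∈ range (2 * N + 1), (X : R⟦X⟧) ^ e (k - N)) atTop
      (𝓝 (∑' j, (X : R⟦X⟧) ^ e j)) := by
    have ht : Tendsto (fun N : ℕ => (range (2 * N + 1)).image fun k : ℕ => (k - N : ℤ)) atTop
        atTop := by
      refine tendsto_atTop_finset_of_monotone (fun M N hMN => ?_) fun j => ⟨j.natAbs, ?_⟩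
      · intro j hj
        simp only [mem_image, mem_range] at hj ⊢
        obtain ⟨k, hk, rfl⟩ := hj
        exact ⟨k + N - M, by omega, by omega⟩
      · simp only [mem_image, mem_range]
        exact ⟨(j + j.natAbs).toNat, by omega, by omega⟩
    refine (hsum.hasSum.comp ht).congr fun N => ?_
    rw [Function.comp_apply, sum_image]
    intro a _ b _ hab
    simpa using hab
  have hdiff : Tendsto (fun N : ℕ => E * ((∏ i ∈ range N, ((1 : R⟦X⟧) + X ^ ((c + d) * i + c))) *
      ∏ i ∈ range N, (1 + X ^ ((c + d) * i + d))) -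
        ∑ k ∈ range (2 * N + 1), (X : R⟦X⟧) ^ e (k - N)) atTop (𝓝 0) := by
    refine tendsto_zero_of_X_pow_dvd fun N => ?_
    rw [prod_mul_prod_eq_sum_gaussBinom he, mul_sum, ← sum_sub_distrib]
    refine dvd_sum fun k hk => ?_
    rw [mem_range] at hk
    have h1 := X_pow_dvd_gaussBinom_mul_tprod_sub_one (R := R) (m := c + d) (by omega)
      (j := min k (2 * N - k)) (k := k) (l := 2 * N - k) (min_le_left _ _) (min_le_right _ _)
    rw [show k + (2 * N - k) = 2 * N by omega] at h1
    simp_rw [← pow_mul] at h1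
    rw [← hE] at h1
    have h2 := mul_dvd_mul (dvd_refl ((X : R⟦X⟧) ^ e (k - N))) h1
    rw [← pow_add] at h2
    have h3 := habs (k - N)
    -- The exponent suffices because `min k (2N - k) = N - |k - N|` and `e (k - N) ≥ |k - N|`.
    refine (pow_dvd_pow _ (by omega)).trans (h2.trans (dvd_of_eq ?_))
    ring
  have h := hdiff.add hS
  simp only [sub_add_cancel, zero_add] at h
  exact tendsto_nhds_unique (((hP c hc).mul (hP d hd)).const_mul E) h

end Theta

/-! ### Extracting residue classes of exponents in characteristic 3 -/

section CoeffClass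

/-- The series whose `n`-th coefficient is the coefficient of `f` of index `3 * n + r`. -/
noncomputable def coeffClass {R : Type*} [CommRing R] (r : ℕ) : R⟦X⟧ →+ R⟦X⟧ where
  toFun f := PowerSeries.mk fun n => coeff (3 * n + r) f
  map_zero' := by ext; simp
  map_add' f g := by ext; simp

theorem coeff_coeffClass {R : Type*} [CommRing R] (r n : ℕ) (f : R⟦X⟧) :
    coeff n (coeffClass r f) = coeff (3 * n + r) f := by
  simp [coeffClass]

theorem continuous_coeffClass {R : Type*} [CommRing R] [TopologicalSpace R] (r : ℕ) :
    Continuous (coeffClass r : R⟦X⟧ →+ R⟦X⟧) := by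
  rw [continuous_iff_continuousAt]
  intro f
  rw [ContinuousAt, tendsto_iff_coeff_tendsto]
  intro d
  simp_rw [coeff_coeffClass]
  exact (continuous_coeff R _).continuousAt

theorem monomial_pow_three (i : ℕ) (a : ZMod 3) :
    (monomial i a) ^ 3 = (monomial (3 * i) a : (ZMod 3)⟦X⟧) := by
  rw [monomial_pow, ZMod.pow_card]

instance charP_powerSeries_zmod_three : CharP (ZMod 3)⟦X⟧ 3 :=
  charP_of_injective_ringHom (C_injective (R := ZMod 3)) 3

theorem three_eq_zero : (3 : (ZMod 3)⟦X⟧) = 0 := CharP.cast_eq_zero _ 3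

theorem continuous_frobenius_three : Continuous (frobenius (ZMod 3)⟦X⟧ 3) :=
  continuous_pow 3

theorem HasSum.pow_three {ι : Type*} {f : ι → (ZMod 3)⟦X⟧} {a : (ZMod 3)⟦X⟧} (h : HasSum f a) :
    HasSum (fun i => f i ^ 3) (a ^ 3) :=
  h.map (frobenius (ZMod 3)⟦X⟧ 3) continuous_frobenius_three

/-- Over `ZMod 3` the cube `g ^ 3` is `g(q^3)`, which does not mix residue classes and leaves the
extraction as `g`. -/
theorem coeffClass_mul_pow_three {r : ℕ} (hr : r < 3) (f g : (ZMod 3)⟦X⟧) :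
    coeffClass r (f * g ^ 3) = coeffClass r f * g := by
  have hg := g.hasSum_of_monomials_self
  have h1 := (hg.pow_three.mul_left f).map (coeffClass r) (continuous_coeffClass r)
  refine h1.unique ((hg.mul_left (coeffClass r f)).congr_fun fun i => ?_)
  ext n
  simp only [Function.comp_apply, coeff_coeffClass, monomial_pow_three]
  simp only [monomial_eq_C_mul_X_pow, mul_left_comm _ (C _), coeff_C_mul, coeff_mul_X_pow',
    coeff_coeffClass]
  by_cases h : i ≤ n
  · rw [if_pos (by omega), if_pos h, show 3 * n + r - 3 * i = 3 * (n - i) + r by omega]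
  · by_cases h' : 3 * i ≤ 3 * n + r
    · omega
    · rw [if_neg h', if_neg h]

end CoeffClass

/-! ### The 3-dissection of the theta function modulo 3 -/

section Theta

variable {φ W : (ZMod 3)⟦X⟧}

/-- Indices divisible by 3 give `φ(q^9) = φ ^ 9`; each of the other two classes gives `X * W ^ 3`,
and `2 = -1`. -/
theorem theta_eq_pow_nine_sub (hφ : HasSum (fun j : ℤ => X ^ (j.natAbs ^ 2)) φ)
    (hW : HasSum (fun j : ℤ => X ^ (3 * j ^ 2 + 2 * j).toNat) W) : φ = φ ^ 9 - X * W ^ 3 := by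
  have h9 := hφ.pow_three.pow_three
  rw [← pow_mul φ] at h9
  have hW3 := hW.pow_three.mul_left X
  have hpos (j : ℤ) : 0 ≤ 3 * j ^ 2 + 2 * j := by
    rcases le_or_gt 0 j with hj | hj
    · positivity
    · nlinarith
  have h := (((Equiv.prodComm (Fin 3) ℤ).trans (Int.divModEquiv 3).symm).hasSum_iff).2 hφ
  have h' := h.prod_fiberwise (g := ![φ ^ 9, X * W ^ 3, X * W ^ 3]) ?_
  · have h3 := h'.unique (hasSum_fintype _)
    rw [Fin.sum_univ_three] at h3
    simp only [Matrix.cons_val] at h3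
    linear_combination h3 + X * W ^ 3 * three_eq_zero
  · intro r
    have hexp (k j : ℤ) (h : k ^ 2 = (3 * j + 1) ^ 2) :
        k.natAbs ^ 2 = 1 + (3 * j ^ 2 + 2 * j).toNat * 3 := by
      zify
      rw [Int.toNat_of_nonneg (hpos j), sq_abs]
      linarith
    fin_cases r
    · refine h9.congr_fun fun j => ?_
      simp [← pow_mul, Int.natAbs_mul]
      ring
    · refine hW3.congr_fun fun j => ?_
      simp only [Function.comp_apply, Equiv.trans_apply, Equiv.prodComm_apply, Prod.swap,
        Int.divModEquiv_symm_apply, ← pow_mul, ← pow_succ']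
      rw [hexp _ j, add_comm]
      simp
      ring
    -- Since `3j + 2 = -(3(-j - 1) + 1)`, this reflection reduces residue 2 to residue 1.
    · let e : ℤ ≃ ℤ := ⟨fun j => -j - 1, fun j => -j - 1, fun j => by ring, fun j => by ring⟩
      refine (e.hasSum_iff.2 hW3).congr_fun fun j => ?_
      simp only [Function.comp_apply, Equiv.trans_apply, Equiv.prodComm_apply, Prod.swap,
        Int.divModEquiv_symm_apply, ← pow_mul, ← pow_succ']
      rw [hexp _ (e j), add_comm]
      simp [e]
      ring

end Theta

theorem tprod_eq_mul_mul_of_mod_three {M : Type*} [CommMonoid M] [TopologicalSpace M]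
    [ContinuousMul M] [T2Space M] {f : ℕ → M} (hf : Multipliable f)
    (h0 : Multipliable fun n => f (3 * n)) (h1 : Multipliable fun n => f (3 * n + 1))
    (h2 : Multipliable fun n => f (3 * n + 2)) :
    ∏' n, f n = (∏' n, f (3 * n)) * (∏' n, f (3 * n + 1)) * ∏' n, f (3 * n + 2) := by
  have ht : Tendsto (fun N : ℕ => 3 * N) atTop atTop := tendsto_id.const_mul_atTop' (by norm_num)
  refine tendsto_nhds_unique (hf.hasProd.tendsto_prod_nat.comp ht)
    (((h0.hasProd.tendsto_prod_nat.mul h1.hasProd.tendsto_prod_nat).mul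
      h2.hasProd.tendsto_prod_nat).congr fun N => ?_)
  rw [Function.comp_apply]
  induction N with
  | zero => simp
  | succ N ih =>
    rw [show 3 * (N + 1) = 3 * N + 1 + 1 + 1 by ring]
    simp only [prod_range_succ, ← ih]
    ac_rfl

/-! ### Product formulas for the theta series -/

section Products

variable (R : Type*) [CommRing R] [TopologicalSpace R]

/-- `∏ (1 - q ^ (2 * n))` over `n ≥ 1`. -/
noncomputable def prodEven : R⟦X⟧ := ∏' n, (1 - X ^ (2 * (n + 1)))

/-- `∏ (1 + q ^ m)` over the odd `m`. -/
noncomputable def prodOddAdd : R⟦X⟧ := ∏' n, (1 + X ^ (2 * n + 1))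

/-- `∏ (1 - q ^ m)` over the odd `m`. -/
noncomputable def prodOddSub : R⟦X⟧ := ∏' n, (1 - X ^ (2 * n + 1))

variable [T2Space R] [IsTopologicalRing R]

theorem hasSum_X_pow_sq :
    HasSum (fun j : ℤ => (X : R⟦X⟧) ^ (j.natAbs ^ 2)) (prodEven R * prodOddAdd R ^ 2) := by
  rw [pow_two (prodOddAdd R)]
  refine hasSum_X_pow_jacobi le_rfl le_rfl fun j => ?_
  push_cast
  rw [sq_abs]
  ring

end Products

section CharThree

/-- The series `∑ q ^ (3 * j ^ 2 + 2 * j)` over the integers `j`. -/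
noncomputable def thetaShift : (ZMod 3)⟦X⟧ := ∑' j : ℤ, X ^ (3 * j ^ 2 + 2 * j).toNat

theorem hasSum_X_pow_three_mul_sq_add :
    HasSum (fun j : ℤ => (X : (ZMod 3)⟦X⟧) ^ (3 * j ^ 2 + 2 * j).toNat) thetaShift ∧
      thetaShift * prodOddAdd (ZMod 3) ^ 2 = prodEven (ZMod 3) ^ 3 := by
  have h := hasSum_X_pow_jacobi (R := ZMod 3) (c := 5) (d := 1) (by norm_num) le_rfl
    (e := fun j : ℤ => (3 * j ^ 2 + 2 * j).toNat) fun j => by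
      rw [Int.toNat_of_nonneg]
      · push_cast; ring
      · rcases le_or_gt 0 j with hj | hj
        · positivity
        · nlinarith
  have hW : thetaShift = _ := h.tsum_eq
  refine ⟨hW ▸ h, ?_⟩
  have hP : prodEven (ZMod 3) ^ 3 = ∏' n, (1 - X ^ ((5 + 1) * (n + 1))) := by
    rw [prodEven, ← Multipliable.tprod_pow
      (multipliable_one_sub_X_pow_comp fun n => by omega)]
    refine tprod_congr fun n => ?_
    rw [sub_pow_char (p := 3), one_pow, ← pow_mul]
    congr 2
    ring
  have hA3 : prodOddAdd (ZMod 3) ^ 3 = ∏' n, (1 + X ^ (2 * (3 * n + 1) + 1)) := by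
    rw [prodOddAdd, ← Multipliable.tprod_pow
      (multipliable_one_add_X_pow fun n => by omega)]
    refine tprod_congr fun n => ?_
    rw [add_pow_char (p := 3), one_pow, ← pow_mul]
    congr 2
    ring
  -- Odd exponents modulo 6: the class of 3 gives the cube of the whole product, and the classes of
  -- 1 and 5 give the factors in the triple product of `thetaShift`.
  have hA := tprod_eq_mul_mul_of_mod_three (f := fun n => (1 : (ZMod 3)⟦X⟧) + X ^ (2 * n + 1))
    (multipliable_one_add_X_pow fun n => by omega) (multipliable_one_add_X_pow fun n => by omega)
    (multipliable_one_add_X_pow fun n => by omega) (multipliable_one_add_X_pow fun n => by omega)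
  rw [← prodOddAdd, ← hA3] at hA
  have h1 : ∏' n, ((1 : (ZMod 3)⟦X⟧) + X ^ (2 * (3 * n) + 1)) = ∏' n, (1 + X ^ ((5 + 1) * n + 1)) :=
    tprod_congr fun n => by congr 2; ring
  have h5 : ∏' n, ((1 : (ZMod 3)⟦X⟧) + X ^ (2 * (3 * n + 2) + 1)) =
      ∏' n, (1 + X ^ ((5 + 1) * n + 5)) :=
    tprod_congr fun n => by congr 2; ring
  rw [h1, h5] at hA
  rw [← hP] at hW
  have hne : prodOddAdd (ZMod 3) ≠ 0 := by
    intro h0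
    have := constantCoeff_tprod (R := ZMod 3) (f := fun n => 1 + X ^ (2 * n + 1))
      (multipliable_one_add_X_pow fun n => by omega) (by simp)
    rw [← prodOddAdd, h0] at this
    simp at this
  refine mul_left_cancel₀ hne ?_
  rw [hW]
  linear_combination (-prodEven (ZMod 3) ^ 3) * hA

end CharThree

/-! ### Vanishing of the required residue classes -/

section Dissection

/-- Extraction of the residue classes modulo `3` from a series given by its dissection. -/
theorem coeffClass_dissection {r : ℕ} (hr : r < 3) (a b c : (ZMod 3)⟦X⟧) :
    coeffClass r (a ^ 3 + X * b ^ 3 + X ^ 2 * c ^ 3) =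
      if r = 0 then a else if r = 1 then b else c := by
  have h (i : ℕ) (g : (ZMod 3)⟦X⟧) :
      coeffClass r (X ^ i * g ^ 3) = coeffClass r (X ^ i) * g := coeffClass_mul_pow_three hr _ _
  have hX (i : ℕ) (hi : i < 3) :
      coeffClass r (X ^ i : (ZMod 3)⟦X⟧) = if r = i then 1 else 0 := by
    ext n
    rw [coeff_coeffClass, coeff_X_pow]
    split_ifs with h1 h2 h2
    · rw [coeff_one, if_pos (by omega)]
    · omega
    · rw [coeff_one, if_neg (by omega)]
    · rw [map_zero]
  have h0 := h 0 a
  have h1 := h 1 b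
  have h2 := h 2 c
  rw [hX _ (by norm_num)] at h0 h1 h2
  rw [pow_zero, one_mul] at h0
  rw [pow_one] at h1
  rw [map_add, map_add, h0, h1, h2]
  interval_cases r <;> simp

variable {φ ψ V W Q F : (ZMod 3)⟦X⟧}

theorem coeffClass_two_eq_zero_of_mul_sq (hψ0 : ψ ≠ 0) (hψ : ψ = ψ ^ 9 + X * V ^ 3)
    (hF : F * ψ ^ 2 = 1) : coeffClass 2 F = 0 := by
  have h1 : F * ψ ^ 3 = (ψ ^ 3) ^ 3 + X * V ^ 3 + X ^ 2 * 0 ^ 3 := by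
    linear_combination ψ * hF + hψ
  have h2 := congrArg (coeffClass 2) h1
  rw [coeffClass_mul_pow_three (by norm_num), coeffClass_dissection (by norm_num)] at h2
  simpa [hψ0] using h2

theorem coeffClass_two_coeffClass_zero_eq_zero (hφ0 : φ ≠ 0) (hψ0 : ψ ≠ 0)
    (hφ : φ = φ ^ 9 - X * W ^ 3) (hψ : ψ = ψ ^ 9 + X * V ^ 3)
    (hW : W * φ = Q) (hV : V * ψ = Q) (hF : F * ψ = φ) : coeffClass 2 (coeffClass 0 F) = 0 := by
  have h1 : F * ψ ^ 3 = (φ ^ 3 * ψ ^ 6 - X * W * V ^ 2) ^ 3 +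
      X * (2 * φ ^ 3 * ψ ^ 3 * V - ψ ^ 6 * W) ^ 3 +
      X ^ 2 * (φ ^ 3 * V ^ 2 - 2 * ψ ^ 3 * W * V) ^ 3 := by
    have h2 : F * ψ ^ 3 = (φ ^ 9 - X * W ^ 3) * (ψ ^ 9 + X * V ^ 3) ^ 2 := by
      rw [← hφ, ← hψ, ← hF]; ring
    rw [h2, sub_pow_char (p := 3), sub_pow_char (p := 3), sub_pow_char (p := 3)]
    linear_combination (-2 * X * φ ^ 9 * ψ ^ 9 * V ^ 3 + 2 * X ^ 2 * ψ ^ 9 * W ^ 3 * V ^ 3) *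
      three_eq_zero
  have h2 := congrArg (coeffClass 0) h1
  rw [coeffClass_mul_pow_three (by norm_num), coeffClass_dissection (by norm_num), if_pos rfl] at h2
  set D := coeffClass 0 F
  -- Multiplying by `φ ^ 3 * ψ ^ 2` lets `Q` replace `W` and `V`, leaving cubes times `ψ ^ 2` and `X
  -- * φ ^ 2`, ready for the second extraction.
  have h3 : D * (φ * ψ) ^ 3 = ψ ^ 2 * (φ ^ 2 * ψ ^ 2) ^ 3 - X * φ ^ 2 * Q ^ 3 := by
    linear_combination φ ^ 3 * ψ ^ 2 * h2 - X * φ ^ 2 * (V ^ 2 * ψ ^ 2 * hW +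
      Q * (V * ψ + Q) * hV)
  have h4 : ψ ^ 2 = (ψ ^ 6) ^ 3 + X * (2 * ψ ^ 3 * V) ^ 3 + X ^ 2 * (V ^ 2) ^ 3 := by
    linear_combination (ψ + ψ ^ 9 + X * V ^ 3) * hψ - 2 * X * ψ ^ 9 * V ^ 3 * three_eq_zero
  have h5 : X * φ ^ 2 = (X * W ^ 2) ^ 3 + X * (φ ^ 6) ^ 3 + X ^ 2 * (φ ^ 3 * W) ^ 3 := by
    linear_combination X * (φ + φ ^ 9 - X * W ^ 3) * hφ - X ^ 2 * φ ^ 9 * W ^ 3 * three_eq_zero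
  have h7 : coeffClass 2 (ψ ^ 2) = V ^ 2 := by
    rw [h4, coeffClass_dissection (by norm_num)]
    simp
  have h8 : coeffClass 2 (X * φ ^ 2) = φ ^ 3 * W := by
    rw [h5, coeffClass_dissection (by norm_num)]
    simp
  have h6 := congrArg (coeffClass 2) h3
  rw [map_sub, coeffClass_mul_pow_three (by norm_num), coeffClass_mul_pow_three (by norm_num),
    coeffClass_mul_pow_three (by norm_num), h7, h8] at h6
  refine (mul_eq_zero.1 (h6.trans ?_)).resolve_right (mul_ne_zero hφ0 hψ0)
  -- The two surviving terms, `V ^ 2 * φ ^ 2 * ψ ^ 2` and `φ ^ 3 * W * Q`, both equal `φ ^ 2 * Q ^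
  -- 2`.
  linear_combination φ ^ 2 * (V * ψ + Q) * hV - φ ^ 2 * Q * hW

end Dissection

/-! ### The generating functions as products and their reduction modulo 3 -/

section MacMahon

theorem continuous_rescale {R : Type*} [CommRing R] [TopologicalSpace R] [IsTopologicalRing R]
    (a : R) : Continuous (rescale a : R⟦X⟧ →+* R⟦X⟧) := by
  rw [continuous_iff_continuousAt]
  intro f
  rw [ContinuousAt, tendsto_iff_coeff_tendsto]
  intro d
  simp_rw [coeff_rescale]
  exact ((continuous_coeff R _).const_mul _).continuousAt

theorem continuous_powerSeries_map {R S : Type*} [CommRing R] [TopologicalSpace R]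
    [CommRing S] [TopologicalSpace S] (g : R →+* S) (hg : Continuous g) :
    Continuous (PowerSeries.map g : R⟦X⟧ →+* S⟦X⟧) := by
  rw [continuous_iff_continuousAt]
  intro f
  rw [ContinuousAt, tendsto_iff_coeff_tendsto]
  intro d
  simp_rw [coeff_map]
  exact (hg.comp (continuous_coeff R _)).continuousAt

section Products

variable (R : Type*) [CommRing R] [TopologicalSpace R] [T2Space R]

theorem constantCoeff_prodEven : constantCoeff (prodEven R) = 1 :=
  constantCoeff_tprod (multipliable_one_sub_X_pow_comp fun n => by omega) (by simp)

theorem constantCoeff_prodOddAdd : constantCoeff (prodOddAdd R) = 1 :=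
  constantCoeff_tprod (multipliable_one_add_X_pow fun n => by omega) (by simp)

theorem constantCoeff_prodOddSub : constantCoeff (prodOddSub R) = 1 :=
  constantCoeff_tprod (multipliable_one_sub_X_pow_comp fun n => by omega) (by simp)

variable [IsTopologicalRing R]

theorem rescale_neg_one_prodEven : rescale (-1) (prodEven R) = prodEven R := by
  rw [prodEven, (multipliable_one_sub_X_pow_comp fun n => by omega).map_tprod _
    (continuous_rescale _)]
  refine tprod_congr fun n => ?_
  rw [map_sub, map_one, map_pow, rescale_X, pow_mul, pow_mul]
  simp

theorem rescale_neg_one_prodOddAdd : rescale (-1) (prodOddAdd R) = prodOddSub R := by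
  rw [prodOddAdd, prodOddSub, (multipliable_one_add_X_pow fun n => by omega).map_tprod _
    (continuous_rescale _)]
  refine tprod_congr fun n => ?_
  rw [map_add, map_one, map_pow, rescale_X, map_neg, map_one, neg_one_mul,
    Odd.neg_pow ⟨n, rfl⟩, sub_eq_add_neg]

/-- Euler's identity between partitions into distinct parts and into odd parts, and the splitting
of `∏ (1 - q ^ n)` into even and odd exponents. -/
theorem prodOddSub_mul_tprod_one_add : prodOddSub R * ∏' n, (1 + X ^ (n + 1)) = 1 ∧
    ∏' n, ((1 : R⟦X⟧) - X ^ (n + 1)) = prodEven R * prodOddSub R := by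
  have h1 := tprod_even_mul_odd (f := fun n => (1 : R⟦X⟧) - X ^ (n + 1))
    (multipliable_one_sub_X_pow_comp fun n => by omega)
    (multipliable_one_sub_X_pow_comp fun n => by omega)
  rw [← prodOddSub, mul_comm] at h1
  simp_rw [show ∀ n, 2 * n + 1 + 1 = 2 * (n + 1) by intro n; ring] at h1
  rw [← prodEven] at h1
  have h2 : (∏' n, ((1 : R⟦X⟧) + X ^ (n + 1))) * ∏' n, (1 - X ^ (n + 1)) = prodEven R := by
    rw [← Multipliable.tprod_mul (multipliable_one_add_X_pow fun n => by omega)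
      (multipliable_one_sub_X_pow_comp fun n => by omega), prodEven]
    refine tprod_congr fun n => ?_
    rw [mul_comm 2, pow_mul]
    ring
  refine ⟨?_, h1.symm⟩
  have hu : IsUnit (prodEven R) := by
    rw [isUnit_iff_constantCoeff, constantCoeff_prodEven]
    exact isUnit_one
  refine hu.mul_left_cancel ?_
  rw [← h1] at h2
  linear_combination h2

end Products

/-- The generating function of the sums over `t`-tuples is the product of the `1 + f k`. -/
theorem summable_tsum_prod_and_hasProd {f : ℕ+ → ℕ} (hf : ∀ k : ℕ+, (k : ℕ) ≤ f k) :
    Summable (fun t => ∑' s : IncreasingTuple t, ∏ k ∈ s.1, macMahonFactor (f k)) ∧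
      HasProd (fun k => 1 + macMahonFactor (f k))
        (∑' t, ∑' s : IncreasingTuple t, ∏ k ∈ s.1, macMahonFactor (f k)) := by
  have hs : Summable fun s : Finset ℕ+ => ∏ k ∈ s, macMahonFactor (f k) :=
    summable_prod_of_tendsto_order_atTop_nhds_top ℤ
      (tendsto_order_of_X_pow_dvd tendsto_PNat_val_atTop_atTop fun k =>
        (pow_dvd_pow _ (hf k)).trans (Dvd.intro _ rfl))
  -- Finite sets of positive integers are grouped by cardinality.
  have h := ((Equiv.sigmaFiberEquiv (Finset.card (α := ℕ+))).hasSum_iff.2 hs.hasSum).sigma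
    fun t => (summable_prod_macMahonFactor f hf t).hasSum
  exact ⟨h.summable, hasProd_one_add_of_hasSum_prod (h.tsum_eq ▸ hs.hasSum)⟩

/-- The numerator of `1 + x/(1-x)^2` is `1 - x + x^2 = (1 + x)^2 - 3x`. -/
theorem one_add_macMahonFactor_map_mul {m : ℕ} (hm : 1 ≤ m) :
    PowerSeries.map (Int.castRingHom (ZMod 3)) (1 + macMahonFactor m) * (1 - X ^ m) ^ 2 =
      (1 + X ^ m) ^ 2 := by
  have h := congrArg (PowerSeries.map (Int.castRingHom (ZMod 3))) (macMahonFactor_mul hm)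
  simp only [map_mul, map_pow, map_sub, map_one, map_X, map_add] at h ⊢
  linear_combination h - X ^ m * three_eq_zero

/-- Reduction modulo `3` of the product of the factors `1 + q ^ m / (1 - q ^ m) ^ 2`. -/
theorem map_mul_tprod_sq_of_hasProd {g : ℕ → ℕ} (hg : ∀ n, n + 1 ≤ g n) {F : ℤ⟦X⟧}
    (hF : HasProd (fun k : ℕ+ => 1 + macMahonFactor (g k.natPred)) F) :
    PowerSeries.map (Int.castRingHom (ZMod 3)) F * (∏' n, (1 - X ^ g n)) ^ 2 =
      (∏' n, (1 + X ^ g n)) ^ 2 := by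
  have h1 := hF.map (PowerSeries.map (Int.castRingHom (ZMod 3)))
    (continuous_powerSeries_map _ continuous_of_discreteTopology)
  have h2 := Equiv.pnatEquivNat.symm.hasProd_iff.2 h1
  have hsub : Multipliable fun n => (1 : (ZMod 3)⟦X⟧) - X ^ g n :=
    multipliable_one_sub_X_pow_comp fun n => by have := hg n; omega
  have hadd : Multipliable fun n => (1 : (ZMod 3)⟦X⟧) + X ^ g n :=
    multipliable_one_add_X_pow fun n => by have := hg n; omega
  rw [← hsub.tprod_pow, ← hadd.tprod_pow, ← h2.tprod_eq,
    ← h2.multipliable.tprod_mul (hsub.pow 2)]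
  refine tprod_congr fun n => ?_
  simp only [Function.comp_apply, Equiv.pnatEquivNat_symm_apply, Nat.natPred_succPNat]
  exact one_add_macMahonFactor_map_mul (by have := hg n; omega)

theorem coeff_mk_modEq_zero {a : ℕ → ℤ} {r n : ℕ} (h : coeff n (coeffClass r
    (PowerSeries.map (Int.castRingHom (ZMod 3)) (PowerSeries.mk a))) = 0) :
    a (3 * n + r) ≡ 0 [ZMOD 3] := by
  refine (ZMod.intCast_eq_intCast_iff _ _ 3).1 ?_
  simpa [coeff_coeffClass] using h

end MacMahon

/-! ### The two congruences -/

theorem corollary5p3 :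
    Summable macMahonU ∧ Summable macMahonC ∧
    ∀ u κ : ℕ → ℤ,
      ∑' t, macMahonU t = PowerSeries.mk u →
      ∑' t, macMahonC t = PowerSeries.mk κ →
      (∀ n : ℕ, u (3 * n + 2) ≡ 0 [ZMOD 3]) ∧ (∀ n : ℕ, κ (9 * n + 6) ≡ 0 [ZMOD 3]) := by
  obtain ⟨hU, hU'⟩ := summable_tsum_prod_and_hasProd (f := fun k => k) fun _ => le_rfl
  obtain ⟨hC, hC'⟩ := summable_tsum_prod_and_hasProd (f := fun k => 2 * (k : ℕ) - 1) fun k => by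
    have := k.pos; omega
  refine ⟨hU, hC, fun u κ hu hκ => ?_⟩
  change HasProd _ (∑' t, macMahonU t) at hU'
  change HasProd _ (∑' t, macMahonC t) at hC'
  rw [hu] at hU'
  rw [hκ] at hC'
  have hUmul := map_mul_tprod_sq_of_hasProd (g := fun n => n + 1) (fun n => le_rfl)
    (F := PowerSeries.mk u) (by simpa only [PNat.natPred_add_one] using hU')
  have hCmul := map_mul_tprod_sq_of_hasProd (g := fun n => 2 * n + 1) (fun n => by omega)
    (F := PowerSeries.mk κ) (by
      convert hC' using 4 with k
      have := PNat.natPred_add_one k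
      omega)
  obtain ⟨hQ, hE⟩ := prodOddSub_mul_tprod_one_add (ZMod 3)
  obtain ⟨hWsum, hW⟩ := hasSum_X_pow_three_mul_sq_add
  rw [hE] at hUmul
  rw [← prodOddAdd, ← prodOddSub] at hCmul
  set P := prodEven (ZMod 3) with hP
  set A := prodOddAdd (ZMod 3) with hA
  set B := prodOddSub (ZMod 3) with hB
  -- The substitution `q ↦ -q` carries the identities for `φ` and `W` to those for `ψ` and `V`.
  set σ : (ZMod 3)⟦X⟧ →+* (ZMod 3)⟦X⟧ := rescale (-1)
  have hσP : σ P = P := rescale_neg_one_prodEven _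
  have hσA : σ A = B := rescale_neg_one_prodOddAdd _
  have hne {f : (ZMod 3)⟦X⟧} (hf : constantCoeff f = 1) : f ≠ 0 := by
    rintro rfl
    simp at hf
  have hP0 : P ≠ 0 := hne (constantCoeff_prodEven _)
  have hA0 : A ≠ 0 := hne (constantCoeff_prodOddAdd _)
  have hB0 : B ≠ 0 := hne (constantCoeff_prodOddSub _)
  have hφ := theta_eq_pow_nine_sub (hasSum_X_pow_sq (ZMod 3)) hWsum
  rw [← hP, ← hA] at hφ
  have hψ := congrArg σ hφ
  have hV := congrArg σ hW
  have hσX : σ X = -X := by simp [σ, rescale_X]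
  simp only [map_sub, map_mul, map_pow, hσP, hσA, hσX] at hψ hV
  replace hψ : P * B ^ 2 = (P * B ^ 2) ^ 9 + X * σ thetaShift ^ 3 := by linear_combination hψ
  have hφ0 : P * A ^ 2 ≠ 0 := mul_ne_zero hP0 (pow_ne_zero _ hA0)
  have hψ0 : P * B ^ 2 ≠ 0 := mul_ne_zero hP0 (pow_ne_zero _ hB0)
  constructor
  · intro n
    refine coeff_mk_modEq_zero ?_
    rw [coeffClass_two_eq_zero_of_mul_sq hψ0 hψ, map_zero]
    · set q := ∏' n, ((1 : (ZMod 3)⟦X⟧) + X ^ (n + 1))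
      linear_combination B ^ 2 * hUmul + (B * q + 1) * hQ
  · intro n
    -- Class 6 modulo 9 is class 0 modulo 3 followed by class 2 modulo 3.
    rw [show 9 * n + 6 = 3 * (3 * n + 2) + 0 by ring]
    refine coeff_mk_modEq_zero ?_
    rw [← coeff_coeffClass,
      coeffClass_two_coeffClass_zero_eq_zero hφ0 hψ0 hφ hψ (Q := P ^ 4), map_zero]
    · linear_combination P * hW
    · linear_combination P * hV
    · linear_combination P * hCmul
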